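/- Let $\xi(s)=(s-1)\pi^{-s/2}\zeta(s)\Gamma(1+s/2)$ and $G(v)=\zeta(\tfrac12+2iv)\,\pi^{-5/4-iv}\,\Gamma(\tfrac54+iv)$ for real $v$. For $s\in\mathbb C$ let $D_s(v)=\tfrac{(2s-1)^2}{8}+2v^2$ and $$F_s(v)=G(v)\,\frac{iv-(2s-1)^2/4}{D_s(v)},\qquad K_s(v)=G(v)\,\frac{-4v^2-iv}{D_s(v)^2}.$$ $D_s$ has no real zero if $\Re s\ne\tfrac12$, and has the real zeros $\pm t/2$ if $s=\tfrac12+it$. Integrals marked $\mathrm{p.v.}$ are limits, as $\varepsilon\to0^+$, of the (absolutely convergent) integrals over the real line with the points at distance at most $\varepsilon$ from the real zeros of the denominator removed; if there is no such zero they are ordinary absolutely convergent integrals. (a) $F_s(v)$ is the negative of the value at $c=-\tfrac54$ of $$\pi^{c-iv}\zeta(-2c+2iv-2)\Gamma(-c+iv)\,\frac{2iv-2s^2-2c+2s-3}{(-2c+2iv+s-3)(-2c+2iv-s-2)}.$$ For all $s\in\mathbb C$, $$\mathrm{p.v.}\!\int_{-\infty}^{\infty}F_s(v)\,dv=1-\frac{\pi^{1/4}}{2\,\Gamma(3/4)},$$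 an ordinary absolutely convergent integral if $\Re s\neq\tfrac12$. (b) The $s$-derivative of the integral in (a) is $0$ at every $s\in\mathbb C$. Moreover $\partial_sF_s(v)=(s-\tfrac12)K_s(v)$ whenever $D_s(v)\ne0$; if $\Re s\neq\tfrac12$, then $K_s$ is integrable, the differentiation may be carried out under the integral sign, and $$\left(s-\tfrac12\right)\int_{-\infty}^{\infty}K_s(v)\,dv=0;$$ and for all $s\in\mathbb C$, $\ \mathrm{p.v.}\!\int_{-\infty}^{\infty}K_s(v)\,dv=0$. (c) The case $s=\tfrac12+it$ gives $$\frac4\pi\int_{-\infty}^{\infty}\frac{\xi(\tfrac12+2iv)}{16v^2+1}\,dv=1-\frac{\pi^{1/4}}{2\,\Gamma(3/4)},$$ with an absolutely convergent integral, and, for every real $t$, $$\mathrm{p.v.}\!\int_{-\infty}^{\infty}\frac{v\,\xi(\tfrac12+2iv)}{(4v^2-t^2)(16v^2+1)}\,dv=0.$$ -/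

import Mathlib

open MeasureTheory Filter Topology Complex

noncomputable section

/-- Riemann's function `ξ(s) = (s - 1) π^(-s/2) ζ(s) Γ(1 + s/2)`. It is only evaluated on the line
`Re s = 1/2`, where no factor has a singularity. -/
def xiFun (s : ℂ) : ℂ :=
  (s - 1) * (Real.pi : ℂ) ^ (-s / 2) * riemannZeta s * Complex.Gamma (1 + s / 2)

/-- The real line with the points at distance at most `ε` from the set `S` removed. -/
def excised (S : Set ℝ) (ε : ℝ) : Set ℝ := {v | ∀ a ∈ S, ε < |v - a|}

/-- `f` has the principal value integral `L` over the real line, with symmetric excision of the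
set `S` of singular points. For `S = ∅` this says that `f` is integrable with integral `L`. -/
def HasPV (f : ℝ → ℂ) (S : Set ℝ) (L : ℂ) : Prop :=
  (∀ ε > 0, IntegrableOn f (excised S ε)) ∧
    Tendsto (fun ε : ℝ => ∫ v in excised S ε, f v) (𝓝[>] 0) (𝓝 L)

/-- The principal value integral itself (meaningful when `HasPV f S L` holds for some `L`). -/
def pvIntegral (f : ℝ → ℂ) (S : Set ℝ) : ℂ :=
  limUnder (𝓝[>] (0 : ℝ)) (fun ε : ℝ => ∫ v in excised S ε, f v)

/-- The integrand on the line with abscissa `c`: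
`π^(c-iv) ζ(-2c+2iv-2) Γ(-c+iv) M(c,s,v)` with the rational transfer function
`M(c,s,v) = (2iv-2s²-2c+2s-3) / ((-2c+2iv+s-3)(-2c+2iv-s-2))`. -/
def lineIntegrand (c : ℝ) (s : ℂ) (v : ℝ) : ℂ :=
  (Real.pi : ℂ) ^ ((c : ℂ) - I * v) * riemannZeta (-2 * c + 2 * I * v - 2) *
    Complex.Gamma (-c + I * v) *
    ((2 * I * v - 2 * s ^ 2 - 2 * c + 2 * s - 3) /
      ((-2 * c + 2 * I * v + s - 3) * (-2 * c + 2 * I * v - s - 2)))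

/-- The denominator `(2s-1)²/8 + 2v²`. -/
def kernelDen (s : ℂ) (v : ℝ) : ℂ := (2 * s - 1) ^ 2 / 8 + 2 * (v : ℂ) ^ 2

/-- The real poles of the kernel: empty if `Re s ≠ 1/2`, and `{t/2, -t/2}` if `s = 1/2 + it`. -/
def kernelPoles (s : ℂ) : Set ℝ := {v | kernelDen s v = 0}

/-- `ζ(1/2+2iv) π^(-5/4-iv) Γ(5/4+iv)`. -/
def zetaWeight (v : ℝ) : ℂ :=
  riemannZeta (1 / 2 + 2 * I * v) * (Real.pi : ℂ) ^ (-5 / 4 - I * (v : ℂ)) *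
    Complex.Gamma (5 / 4 + I * v)

/-- `ζ(1/2+2iv) π^(-5/4-iv) Γ(5/4+iv) (iv - (2s-1)²/4) / ((2s-1)²/8 + 2v²)`. -/
def mainIntegrand (s : ℂ) (v : ℝ) : ℂ :=
  zetaWeight v * (I * v - (2 * s - 1) ^ 2 / 4) / kernelDen s v

/-- `ζ(1/2+2iv) π^(-5/4-iv) Γ(5/4+iv) (-4v² - iv) / ((2s-1)²/8 + 2v²)²`. -/
def derivIntegrand (s : ℂ) (v : ℝ) : ℂ :=
  zetaWeight v * (-4 * (v : ℂ) ^ 2 - I * v) / kernelDen s v ^ 2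

/-- The constant `1 - π^(1/4) / (2 Γ(3/4))`. -/
def cstVal : ℝ := 1 - Real.pi ^ (1 / 4 : ℝ) / (2 * Real.Gamma (3 / 4))

end

/-! Write Λ for the completed zeta function. On the critical line Γ(5/4+iv) = (1/4+iv)Γ(1/4+iv), so
G(v) = (1+4iv)/(4π) · Λ(1/2+2iv), and the functional equation makes Λ(1/2+2iv) (`critZeta`) even in
v. Multiplying out the numerator splits F_s into -Λ/(2π) plus a constant times (v/D_s)Λ
(`mainIntegrand_eq`). The second term is odd and alone carries the poles, so it contributes nothing
over a symmetrically excised line (`hasPV_of_odd`). Hence the integral does not depend on s and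
equals -(1/2π)∫Λ. Likewise K_s is a multiple of the odd function v(1+16v²)Λ/D_s², and ξ is
-(16v²+1)/8 · Λ, which gives (b) and (c).

It remains to evaluate ∫Λ. Mellin inversion at x = 1 of θ(x) - 1 - x^(-1/2), where θ(x) = Σ
exp(-πn²x), gives ∫Λ = π(θ(1) - 2) (`integral_critZeta`); integrability follows from linear growth
of ζ against exponential decay of Γ.

The value θ(1) = π^(1/4)/Γ(3/4) comes from Gauss's arithmetic-geometric mean. The squares of θ and
of the alternating theta series perform an AGM step under t ↦ 2t and tend to 1. The complete
elliptic integral is invariant under such steps, so at the theta squares it equals π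
(`agmIntegral_theta`). At t = 1 the two squares have ratio √2, and the integral for (√2, 1) is a
beta value (`agmIntegral_sqrt_two`). -/

/-! ### Integrability of Λ on the critical line. -/

section Decay
open Set

/-- The fractional part, cut off to `(1, ∞)`. -/
noncomputable def fractTail : ℝ → ℂ := (Ioi (1 : ℝ)).indicator fun t => ((Int.fract t : ℝ) : ℂ)

lemma measurable_fractTail : Measurable fractTail :=
  (measurable_ofReal.comp measurable_fract).indicator measurableSet_Ioi

lemma norm_fractTail_le_one (t : ℝ) : ‖fractTail t‖ ≤ 1 := by
  unfold fractTail
  refine (norm_indicator_le_norm_self _ _).trans ?_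
  rw [Complex.norm_real, Real.norm_of_nonneg (Int.fract_nonneg t)]
  exact (Int.fract_lt_one t).le

lemma fractTail_isBigO_atTop : fractTail =O[atTop] fun t : ℝ => t ^ (-(0 : ℝ)) := by
  refine Asymptotics.IsBigO.of_bound 1 (Eventually.of_forall fun t => ?_)
  simpa using norm_fractTail_le_one t

lemma fractTail_isBigO_zero (b : ℝ) : fractTail =O[𝓝[>] 0] fun t : ℝ => t ^ (-b) := by
  refine Asymptotics.IsBigO.of_bound 1 ?_
  filter_upwards [Ioo_mem_nhdsGT (zero_lt_one' ℝ)] with t ht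
  have : fractTail t = 0 := indicator_of_notMem (by simpa using ht.2.le) _
  rw [this, norm_zero]
  positivity

lemma locallyIntegrableOn_fractTail : LocallyIntegrableOn fractTail (Ioi 0) := by
  have : LocallyIntegrable fractTail volume := by
    refine LocallyIntegrable.mono (locallyIntegrable_const (1 : ℝ))
      measurable_fractTail.aestronglyMeasurable (Eventually.of_forall fun t => ?_)
    simpa using norm_fractTail_le_one t
  exact this.locallyIntegrableOn _

/-- Boundedness at infinity limits convergence to Re s < 0. The function vanishes near 0, so any
exponent below Re s serves there; `s.re - 1` is one choice. -/
lemma differentiableAt_mellin_fractTail {s : ℂ} (hs : s.re < 0) :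
    DifferentiableAt ℂ (mellin fractTail) s :=
  mellin_differentiableAt_of_isBigO_rpow locallyIntegrableOn_fractTail fractTail_isBigO_atTop hs
    (fractTail_isBigO_zero (s.re - 1)) (by linarith)

/-- Abel summation writes ζ(s) as s∫₁^∞ ⌊t⌋ t^(-s-1) dt; then ⌊t⌋ = t - {t}. -/
lemma riemannZeta_eq_mellin_fractTail_of_one_lt_re {s : ℂ} (hs : 1 < s.re) :
    riemannZeta s = s / (s - 1) - s * mellin fractTail (-s) := by
  have h1 := LSeries_eq_mul_integral_of_nonneg (fun _ => (1 : ℝ)) (r := 1) zero_le_one hs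
    (by simpa using Asymptotics.isBigO_refl _ _) (fun _ => zero_le_one)
  have h2 : LSeries (fun _ => ((1 : ℝ) : ℂ)) s = riemannZeta s := by
    rw [← LSeries_one_eq_riemannZeta hs]; simp [Pi.one_def]
  rw [h2] at h1
  have hs1 : s - 1 ≠ 0 := by
    intro h
    have := congrArg Complex.re h
    simp at this
    linarith
  have h3 : ∫ t in Ioi (1 : ℝ), (t : ℂ) ^ (-s) = 1 / (s - 1) := by
    rw [integral_Ioi_cpow_of_lt (by simpa using hs) one_pos, ofReal_one, one_cpow, neg_div,
      ← div_neg]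
    congr 1; ring
  have h4 : mellin fractTail (-s) =
      ∫ t in Ioi (1 : ℝ), (t : ℂ) ^ (-(s + 1)) * ((Int.fract t : ℝ) : ℂ) := by
    unfold mellin fractTail
    have : ∀ t : ℝ, (t : ℂ) ^ (-s - 1) • (Ioi (1 : ℝ)).indicator
        (fun t => ((Int.fract t : ℝ) : ℂ)) t = (Ioi (1 : ℝ)).indicator
        (fun t : ℝ => (t : ℂ) ^ (-(s + 1)) * ((Int.fract t : ℝ) : ℂ)) t := by
      intro t
      by_cases h : t ∈ Ioi (1 : ℝ)
      · simp only [indicator_of_mem h, smul_eq_mul]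
        congr 2; ring
      · simp only [indicator_of_notMem h, smul_zero]
    simp_rw [this]
    rw [setIntegral_indicator measurableSet_Ioi]
    congr 2
    ext x; simp only [mem_inter_iff, mem_Ioi]
    constructor
    · exact fun h => h.2
    · exact fun h => ⟨by linarith, h⟩
  have h5 : IntegrableOn (fun t : ℝ => (t : ℂ) ^ (-(s + 1)) * ((Int.fract t : ℝ) : ℂ))
      (Ioi (1 : ℝ)) := by
    have hi : IntegrableOn (fun t : ℝ => (t : ℂ) ^ (-(s + 1))) (Ioi (1 : ℝ)) :=
      integrableOn_Ioi_cpow_of_lt (by simp; linarith) one_pos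
    refine Integrable.mono hi (hi.aestronglyMeasurable.mul
      (measurable_ofReal.comp measurable_fract).aestronglyMeasurable)
      (Eventually.of_forall fun t => ?_)
    rw [norm_mul, Complex.norm_real, Real.norm_of_nonneg (Int.fract_nonneg t)]
    exact mul_le_of_le_one_right (norm_nonneg _) (Int.fract_lt_one t).le
  rw [h1, h4]
  have h6 : ∫ t in Ioi (1 : ℝ), (∑ k ∈ Finset.Icc 1 ⌊t⌋₊, ((1 : ℝ) : ℂ)) * (t : ℂ) ^ (-(s + 1)) =
      ∫ t in Ioi (1 : ℝ), ((t : ℂ) ^ (-s) - (t : ℂ) ^ (-(s + 1)) * ((Int.fract t : ℝ) : ℂ)) := by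
    refine setIntegral_congr_fun measurableSet_Ioi fun t ht => ?_
    have ht0 : (0 : ℝ) < t := lt_trans one_pos ht
    have ht' : (t : ℂ) ≠ 0 := by exact_mod_cast ht0.ne'
    have hfl : (∑ k ∈ Finset.Icc 1 ⌊t⌋₊, ((1 : ℝ) : ℂ)) = (t : ℂ) - ((Int.fract t : ℝ) : ℂ) := by
      rw [← ofReal_sub, Int.self_sub_fract]
      simp only [ofReal_one, Finset.sum_const, Nat.card_Icc, nsmul_eq_mul, mul_one,
        Nat.add_sub_cancel]
      rw [← natCast_floor_eq_intCast_floor ht0.le]; simp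
    have hp : (t : ℂ) ^ (-s) = t * (t : ℂ) ^ (-(s + 1)) := by
      rw [show -s = 1 + -(s + 1) by ring, cpow_add _ _ ht', cpow_one]
    simp only [hfl, hp]; ring
  rw [h6, integral_sub (integrableOn_Ioi_cpow_of_lt (by simpa using hs) one_pos) h5, h3]
  ring

lemma riemannZeta_eq_mellin_fractTail {s : ℂ} (hs : 0 < s.re) (hs1 : s.im ≠ 0) :
    riemannZeta s = s / (s - 1) - s * mellin fractTail (-s) := by
  -- The sign of `e` selects the quadrant of Re z > 0 containing `s`. It is convex and avoids the
  -- pole at 1, and `s + 1` lies in it with real part above 1, so the identity theorem applies.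
  obtain ⟨e, hes⟩ : ∃ e : ℝ, 0 < e * s.im := ⟨s.im, mul_self_pos.mpr hs1⟩
  let U : Set ℂ := {z | 0 < z.re} ∩ {z | 0 < e * z.im}
  have hUo : IsOpen U := (isOpen_lt continuous_const continuous_re).inter
    (isOpen_lt continuous_const (continuous_const.mul continuous_im))
  have hUc : Convex ℝ U := by
    refine (convex_halfSpace_re_gt 0).inter ?_
    have hl : IsLinearMap ℝ (fun z : ℂ => e * z.im) :=
      ⟨fun x y => by simp [mul_add], fun c x => by simp [mul_left_comm]⟩
    exact (convex_Ioi (0 : ℝ)).is_linear_preimage hl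
  have hne : ∀ z ∈ U, z ≠ 1 := by
    rintro z ⟨-, hz⟩ rfl
    simp at hz
  have hf : AnalyticOnNhd ℂ riemannZeta U := DifferentiableOn.analyticOnNhd
    (fun z hz => (differentiableAt_riemannZeta (hne z hz)).differentiableWithinAt) hUo
  have hg : AnalyticOnNhd ℂ (fun z => z / (z - 1) - z * mellin fractTail (-z)) U := by
    refine DifferentiableOn.analyticOnNhd (fun z hz => DifferentiableAt.differentiableWithinAt ?_)
      hUo
    have h1 : DifferentiableAt ℂ (fun z => mellin fractTail (-z)) z :=
      (differentiableAt_mellin_fractTail (by simpa using hz.1)).comp z differentiableAt_fun_id.neg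
    have h2 : z - 1 ≠ 0 := sub_ne_zero.mpr (hne z hz)
    fun_prop (disch := assumption)
  have hz0 : (s + 1) ∈ U := ⟨by simp; linarith, by simpa using hes⟩
  refine hf.eqOn_of_preconnected_of_eventuallyEq hg hUc.isPreconnected hz0 ?_ ⟨hs, hes⟩
  filter_upwards [(isOpen_lt continuous_const continuous_re).mem_nhds
    (show (1 : ℝ) < (s + 1).re by simpa using hs)] with z hz
  exact riemannZeta_eq_mellin_fractTail_of_one_lt_re hz

/-- The Mellin integral is bounded uniformly along a vertical line, so only the factor `s` in front
of it grows. -/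
lemma exists_norm_riemannZeta_le {σ : ℝ} (hσ : 0 < σ) (hσ1 : σ < 1) :
    ∃ C, 0 ≤ C ∧ ∀ t : ℝ, t ≠ 0 → ‖riemannZeta (σ + t * I)‖ ≤ C * (1 + |t|) := by
  set M : ℝ := ∫ t in Ioi (0 : ℝ), ‖(t : ℂ) ^ (((-σ : ℝ) : ℂ) - 1) • fractTail t‖
  have hM0 : 0 ≤ M := integral_nonneg fun _ => norm_nonneg _
  have hM : ∀ t : ℝ, ‖mellin fractTail (-(σ + t * I))‖ ≤ M := by
    intro t
    unfold mellin
    refine (norm_integral_le_integral_norm _).trans (le_of_eq ?_)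
    refine setIntegral_congr_fun measurableSet_Ioi fun x hx => ?_
    simp only [norm_smul]
    rw [norm_cpow_eq_rpow_re_of_pos hx, norm_cpow_eq_rpow_re_of_pos hx]
    simp
  refine ⟨1 / (1 - σ) + M, by have : 0 < 1 - σ := by linarith
                              positivity, fun t ht => ?_⟩
  have hn : ‖(σ : ℂ) + t * I‖ ≤ 1 + |t| := by
    refine (norm_add_le _ _).trans ?_
    simp only [norm_mul, Complex.norm_real, Complex.norm_I, Real.norm_eq_abs, abs_of_pos hσ, mul_one]
    linarith
  have hd : 1 - σ ≤ ‖(σ : ℂ) + t * I - 1‖ := by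
    have := abs_re_le_norm ((σ : ℂ) + t * I - 1)
    simp at this
    rw [abs_of_neg (by linarith)] at this
    linarith
  rw [riemannZeta_eq_mellin_fractTail (by simpa using hσ) (by simpa using ht)]
  refine (norm_sub_le _ _).trans ?_
  rw [norm_div, norm_mul, add_mul]
  refine add_le_add ?_ ?_
  · rw [div_eq_mul_inv, mul_comm, one_div]
    have : 0 < 1 - σ := by linarith
    gcongr
  · rw [mul_comm]
    gcongr
    exact hM t

lemma norm_betaIntegral_le {u v : ℂ} :
    ‖betaIntegral u v‖ ≤ ∫ x in Ioc (0 : ℝ) 1, x ^ (u.re - 1) * (1 - x) ^ (v.re - 1) := by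
  unfold betaIntegral
  rw [intervalIntegral.integral_of_le zero_le_one, integral_Ioc_eq_integral_Ioo,
    integral_Ioc_eq_integral_Ioo]
  refine (norm_integral_le_integral_norm _).trans (le_of_eq ?_)
  refine setIntegral_congr_fun measurableSet_Ioo fun x hx => ?_
  have h2 : (1 - (x : ℂ)) = ((1 - x : ℝ) : ℂ) := by push_cast; ring
  simp only [norm_mul]
  rw [h2, norm_cpow_eq_rpow_re_of_pos hx.1, norm_cpow_eq_rpow_re_of_pos (by linarith [hx.2])]
  simp

lemma norm_sq_sin_pi_mul_quarter_add (v : ℝ) :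
    ‖Complex.sin (Real.pi * (1 / 4 + I * v))‖ ^ 2 = Real.cosh (2 * (Real.pi * v)) / 2 := by
  have h1 : (Real.pi : ℂ) * (1 / 4 + I * v) =
      ((Real.pi / 4 : ℝ) : ℂ) + ((Real.pi * v : ℝ) : ℂ) * I := by
    push_cast; ring
  rw [h1, Complex.sin_add_mul_I, ← ofReal_sin, ← ofReal_cos, ← ofReal_cosh, ← ofReal_sinh,
    ← ofReal_mul, ← ofReal_mul, Complex.sq_norm, normSq_add_mul_I, Real.sin_pi_div_four,
    Real.cos_pi_div_four, Real.cosh_two_mul]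
  have := Real.sq_sqrt (show (0 : ℝ) ≤ 2 by norm_num)
  nlinarith [this]

/-- No Stirling formula is needed. The beta integral with Γ(1/2) bounds |Γ(1/4+iv)| by a constant
times |Γ(3/4+iv)|, and reflection with conjugation computes the product of these two moduli. The
fourth power avoids a root of cosh. -/
lemma exists_norm_Gamma_quarter_le :
    ∃ C, 0 ≤ C ∧ ∀ v : ℝ, ‖Gamma (1 / 4 + I * v)‖ ^ 4 ≤ C / Real.cosh (2 * (Real.pi * v)) := by
  set B : ℝ := ∫ x in Ioc (0 : ℝ) 1, x ^ ((1 / 4 : ℝ) - 1) * (1 - x) ^ ((1 / 2 : ℝ) - 1)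
  set g : ℝ := ‖Gamma (1 / 2 : ℂ)‖
  have hg : 0 < g := norm_pos_iff.mpr (Gamma_ne_zero_of_re_pos (by norm_num))
  refine ⟨2 * (B / g * Real.pi) ^ 2, by positivity, fun v => ?_⟩
  have h1 : ‖Gamma (1 / 4 + I * v)‖ * g ≤ ‖Gamma (3 / 4 + I * v)‖ * B := by
    have h := Gamma_mul_Gamma_eq_betaIntegral (s := 1 / 4 + I * v) (t := 1 / 2)
      (by norm_num) (by norm_num)
    rw [show (1 / 4 + I * v + 1 / 2 : ℂ) = 3 / 4 + I * v by ring] at h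
    have h' := congrArg norm h
    rw [norm_mul, norm_mul] at h'
    rw [h']
    gcongr
    refine norm_betaIntegral_le.trans (le_of_eq ?_)
    norm_num [B]
  have h2 : ‖Gamma (3 / 4 + I * v)‖ * ‖Gamma (1 / 4 + I * v)‖ =
      Real.pi / ‖Complex.sin (Real.pi * (1 / 4 + I * v))‖ := by
    have h := Gamma_mul_Gamma_one_sub (1 / 4 + I * v)
    have hc : (starRingEnd ℂ) (3 / 4 + I * v) = 1 - (1 / 4 + I * v) := by
      simp [Complex.conj_ofReal]; ring_nf
      simp only [map_ofNat, sub_left_inj]; norm_num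
    rw [← hc, Gamma_conj] at h
    have h' := congrArg norm h
    rw [norm_mul, norm_div, Complex.norm_conj, Complex.norm_real,
      Real.norm_of_nonneg Real.pi_pos.le] at h'
    rw [← h', mul_comm]
  have h3 : ‖Gamma (1 / 4 + I * v)‖ ^ 2 ≤
      B / g * (Real.pi / ‖Complex.sin (Real.pi * (1 / 4 + I * v))‖) := by
    rw [← h2, sq]
    have : ‖Gamma (1 / 4 + I * v)‖ ≤ B / g * ‖Gamma (3 / 4 + I * v)‖ := by
      rw [div_mul_eq_mul_div, le_div_iff₀ hg]; linarith
    calc _ ≤ (B / g * ‖Gamma (3 / 4 + I * v)‖) * ‖Gamma (1 / 4 + I * v)‖ := by gcongr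
      _ = _ := by ring
  calc ‖Gamma (1 / 4 + I * v)‖ ^ 4 = (‖Gamma (1 / 4 + I * v)‖ ^ 2) ^ 2 := by ring
    _ ≤ (B / g * (Real.pi / ‖Complex.sin (Real.pi * (1 / 4 + I * v))‖)) ^ 2 := by gcongr
    _ = (B / g * Real.pi) ^ 2 / ‖Complex.sin (Real.pi * (1 / 4 + I * v))‖ ^ 2 := by ring
    _ = _ := by rw [norm_sq_sin_pi_mul_quarter_add]; field_simp

/-- The completed zeta function on the critical line. -/
noncomputable def critZeta (v : ℝ) : ℂ := completedRiemannZeta (1 / 2 + 2 * I * v)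

lemma critLine_re (v : ℝ) : (1 / 2 + 2 * I * v : ℂ).re = 1 / 2 := by simp

lemma critLine_ne_zero (v : ℝ) : (1 / 2 + 2 * I * v : ℂ) ≠ 0 := fun h => by
  have := critLine_re v
  rw [h] at this; norm_num at this

lemma critLine_ne_one (v : ℝ) : (1 / 2 + 2 * I * v : ℂ) ≠ 1 := fun h => by
  have := critLine_re v
  rw [h] at this; norm_num at this

lemma continuous_critZeta : Continuous critZeta := by
  refine continuous_iff_continuousAt.mpr fun v => ?_
  have h := (differentiableAt_completedZeta (critLine_ne_zero v) (critLine_ne_one v)).continuousAt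
  exact ContinuousAt.comp (f := fun v : ℝ => (1 / 2 + 2 * I * v : ℂ)) h (by fun_prop)

lemma critZeta_neg (v : ℝ) : critZeta (-v) = critZeta v := by
  unfold critZeta
  rw [← completedRiemannZeta_one_sub]
  congr 1
  push_cast; ring

lemma critZeta_eq (v : ℝ) : critZeta v = (Real.pi : ℂ) ^ (-(1 / 4 + I * v) : ℂ) *
    Gamma (1 / 4 + I * v) * riemannZeta (1 / 2 + 2 * I * v) := by
  have hG : Gammaℝ (1 / 2 + 2 * I * v) ≠ 0 :=
    Gammaℝ_ne_zero_of_re_pos (by rw [critLine_re]; norm_num)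
  have h := riemannZeta_def_of_ne_zero (critLine_ne_zero v)
  rw [eq_div_iff hG] at h
  rw [critZeta, ← h, Gammaℝ_def]
  rw [show (-(1 / 2 + 2 * I * v) / 2 : ℂ) = -(1 / 4 + I * v) by ring,
    show ((1 / 2 + 2 * I * v) / 2 : ℂ) = 1 / 4 + I * v by ring]
  ring

/-- Twelve is 4 + 8: four powers absorb |ζ|⁴, and eight leave quadratic decay after a fourth root.
-/
lemma pow_twelve_le_cosh : ∃ K, 0 ≤ K ∧ ∀ v : ℝ,
    (1 + |v|) ^ 12 ≤ K * Real.cosh (2 * (Real.pi * v)) := by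
  refine ⟨2 * (Nat.factorial 12 * Real.exp 1), by positivity, fun v => ?_⟩
  have h1 := Real.pow_div_factorial_le_exp (1 + |v|) (by positivity) 12
  rw [div_le_iff₀ (by positivity), Real.exp_add] at h1
  have h2 : Real.exp |v| ≤ 2 * Real.cosh (2 * (Real.pi * v)) := by
    rw [← Real.cosh_abs, Real.cosh_eq]
    have : |v| ≤ |2 * (Real.pi * v)| := by
      rw [abs_mul, abs_mul, abs_of_pos Real.pi_pos, abs_two]
      have := abs_nonneg v
      nlinarith [Real.pi_gt_three]
    have h3 := Real.exp_le_exp.mpr this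
    have h4 := Real.exp_pos (-|2 * (Real.pi * v)|)
    linarith
  calc _ ≤ Real.exp 1 * Real.exp |v| * (Nat.factorial 12) := h1
    _ ≤ Real.exp 1 * (2 * Real.cosh (2 * (Real.pi * v))) * (Nat.factorial 12) := by gcongr
    _ = _ := by ring

lemma exists_norm_critZeta_le :
    ∃ C : ℝ, 0 ≤ C ∧ ∀ v : ℝ, v ≠ 0 → ‖critZeta v‖ ≤ C * (1 + v ^ 2)⁻¹ := by
  obtain ⟨A, hA0, hA⟩ := exists_norm_riemannZeta_le (σ := 1 / 2) (by norm_num) (by norm_num)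
  obtain ⟨B, hB0, hB⟩ := exists_norm_Gamma_quarter_le
  obtain ⟨K, hK0, hK⟩ := pow_twelve_le_cosh
  set p : ℝ := Real.pi ^ (-(1 / 4) : ℝ)
  have hp0 : 0 ≤ p := Real.rpow_nonneg Real.pi_pos.le _
  set M : ℝ := p ^ 4 * B * (2 * A) ^ 4 * K
  have hM0 : 0 ≤ M := by positivity
  refine ⟨1 + M, by linarith, fun v hv => ?_⟩
  have hz : ‖riemannZeta (1 / 2 + 2 * I * v)‖ ≤ 2 * A * (1 + |v|) := by
    have := hA (2 * v) (by simpa using hv)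
    rw [show (((1 / 2 : ℝ) : ℂ) + ((2 * v : ℝ) : ℂ) * I) = 1 / 2 + 2 * I * v by
      push_cast; ring] at this
    refine this.trans ?_
    rw [abs_mul, abs_two]
    have := abs_nonneg v
    nlinarith
  have hpi : ‖(Real.pi : ℂ) ^ (-(1 / 4 + I * v) : ℂ)‖ = p := by
    rw [norm_cpow_eq_rpow_re_of_pos Real.pi_pos]
    congr 1; simp
  set c := Real.cosh (2 * (Real.pi * v))
  have hc : 0 < c := Real.cosh_pos _
  have h4 : ‖critZeta v‖ ^ 4 ≤ M * ((1 + |v|)⁻¹) ^ 8 := by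
    rw [critZeta_eq, norm_mul, norm_mul, hpi, mul_pow, mul_pow]
    calc p ^ 4 * ‖Gamma (1 / 4 + I * v)‖ ^ 4 * ‖riemannZeta (1 / 2 + 2 * I * v)‖ ^ 4
        ≤ p ^ 4 * (B / c) * (2 * A * (1 + |v|)) ^ 4 := by
          gcongr
          exact hB v
      _ = p ^ 4 * B * (2 * A) ^ 4 * ((1 + |v|) ^ 12 / c) * ((1 + |v|)⁻¹) ^ 8 := by
          have : 1 + |v| ≠ 0 := by positivity
          field_simp
      _ ≤ p ^ 4 * B * (2 * A) ^ 4 * K * ((1 + |v|)⁻¹) ^ 8 := by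
          gcongr
          rw [div_le_iff₀ hc]
          exact hK v
  -- M ≤ (1 + M)⁴ replaces the extraction of a fourth root of M.
  have h5 : ‖critZeta v‖ ^ 4 ≤ ((1 + M) * ((1 + |v|)⁻¹) ^ 2) ^ 4 := by
    refine h4.trans ?_
    rw [mul_pow, ← pow_mul]
    gcongr
    nlinarith [pow_nonneg hM0 2, pow_nonneg hM0 3, pow_nonneg hM0 4]
  have h6 := le_of_pow_le_pow_left₀ (by norm_num) (by positivity) h5
  refine h6.trans ?_
  gcongr
  rw [inv_pow]
  gcongr
  rw [add_sq, sq_abs]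
  have := abs_nonneg v
  linarith

lemma integrable_critZeta : Integrable critZeta := by
  obtain ⟨C, hC0, hC⟩ := exists_norm_critZeta_le
  refine Integrable.mono' (integrable_inv_one_add_sq.const_mul C)
    continuous_critZeta.aestronglyMeasurable ?_
  have : ∀ᵐ v : ℝ, v ≠ 0 := by simp [ae_iff]
  filter_upwards [this] with v hv using hC v hv

end Decay

/-! ### Mellin inversion for the theta function. -/

section Inversion
open Set HurwitzZeta

/-- The theta kernel with its leading terms at `0` and `∞` both subtracted. -/
noncomputable def thetaRemainder (x : ℝ) : ℂ :=
  (evenKernel 0 x : ℂ) - 1 - (x : ℂ) ^ (-(1 / 2) : ℂ)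

lemma hasMellin_cpow_Ioi (a : ℂ) {s : ℂ} (hs : s.re + a.re < 0) :
    HasMellin (indicator (Ioi 1) (fun t => ↑t ^ a : ℝ → ℂ)) s (-1 / (s + a)) := by
  have hre : (s + a - 1).re < -1 := by simp; linarith
  have hpt : ∀ t ∈ Ioi (0 : ℝ), (t : ℂ) ^ (s - 1) • indicator (Ioi 1) (fun t => ↑t ^ a : ℝ → ℂ) t =
      indicator (Ioi 1) (fun t : ℝ => (t : ℂ) ^ (s + a - 1)) t := by
    intro t ht
    by_cases h : t ∈ Ioi (1 : ℝ)
    · simp only [indicator_of_mem h, smul_eq_mul]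
      rw [← cpow_add _ _ (ofReal_ne_zero.mpr (ne_of_gt ht))]
      congr 1; ring
    · simp only [indicator_of_notMem h, smul_zero]
  have hint := integrableOn_Ioi_cpow_of_lt hre one_pos
  have hsub : Ioi (0 : ℝ) ∩ Ioi 1 = Ioi 1 := inter_eq_right.mpr (Ioi_subset_Ioi zero_le_one)
  constructor
  · rw [MellinConvergent, integrableOn_congr_fun hpt measurableSet_Ioi, IntegrableOn,
      integrable_indicator_iff measurableSet_Ioi, IntegrableOn,
      Measure.restrict_restrict measurableSet_Ioi, inter_comm, hsub]
    exact hint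
  · rw [mellin, setIntegral_congr_fun measurableSet_Ioi hpt,
      setIntegral_indicator measurableSet_Ioi, hsub, integral_Ioi_cpow_of_lt hre one_pos]
    simp

/-- `f_modif` already subtracts 1 beyond 1 and x^(-1/2) before 1; the two indicators subtract each
term on the other side. The point 1 is excluded because `f_modif` vanishes there by convention. -/
lemma thetaRemainder_eq {x : ℝ} (hx : 0 < x) (hx1 : x ≠ 1) :
    thetaRemainder x = (hurwitzEvenFEPair 0).f_modif x -
      indicator (Ioc 0 1) (fun _ => 1 : ℝ → ℂ) x -
      indicator (Ioi 1) (fun t => ↑t ^ (-(1 / 2) : ℂ) : ℝ → ℂ) x := by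
  have hc : ((x ^ (-(1 / 2) : ℝ) : ℝ) : ℂ) = (x : ℂ) ^ (-(1 / 2) : ℂ) := by
    rw [ofReal_cpow hx.le]; push_cast; rfl
  rcases lt_or_gt_of_ne hx1 with h | h
  · rw [indicator_of_mem (show x ∈ Ioc (0 : ℝ) 1 from ⟨hx, h.le⟩),
      indicator_of_notMem (by simpa using h.le), WeakFEPair.f_modif, Pi.add_apply,
      indicator_of_notMem (by simpa using h.le),
      indicator_of_mem (show x ∈ Ioo (0 : ℝ) 1 from ⟨hx, h⟩)]
    simp only [hurwitzEvenFEPair, Function.comp_apply, thetaRemainder, one_mul, smul_eq_mul,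
      mul_one, hc]
    ring
  · rw [indicator_of_notMem (show x ∉ Ioc (0 : ℝ) 1 from fun h' => by linarith [h'.2]),
      indicator_of_mem (show x ∈ Ioi (1 : ℝ) from h), WeakFEPair.f_modif, Pi.add_apply,
      indicator_of_mem (show x ∈ Ioi (1 : ℝ) from h),
      indicator_of_notMem (show x ∉ Ioo (0 : ℝ) 1 from fun h' => by linarith [h'.2])]
    simp only [hurwitzEvenFEPair, Function.comp_apply, thetaRemainder, if_true]
    ring

/-- The Mellin transforms of the two truncated powers are exactly the polar terms separating Λ₀ from
Λ. The strip is where both converge. -/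
lemma hasMellin_thetaRemainder {u : ℂ} (h0 : 0 < u.re) (h1 : u.re < 1 / 2) :
    HasMellin thetaRemainder u (2 * completedRiemannZeta (2 * u)) := by
  have hm := (hurwitzEvenFEPair 0).isStrongFEPair_toStrongFEPair.hasMellin u
  have hm1 := hasMellin_one_Ioc h0
  have hm2 := hasMellin_cpow_Ioi (-(1 / 2)) (s := u) (by simp; linarith)
  have hs1 := hasMellin_sub hm.1 hm1.1
  have hs2 := hasMellin_sub hs1.1 hm2.1
  have hae : ∀ᵐ x : ℝ ∂(volume.restrict (Ioi 0)), (x : ℂ) ^ (u - 1) •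
      ((hurwitzEvenFEPair 0).f_modif x - indicator (Ioc 0 1) (fun _ => 1 : ℝ → ℂ) x -
      indicator (Ioi 1) (fun t => ↑t ^ (-(1 / 2) : ℂ) : ℝ → ℂ) x) =
      (x : ℂ) ^ (u - 1) • thetaRemainder x := by
    have hne : ∀ᵐ x : ℝ, x ≠ 1 := by simp [ae_iff]
    filter_upwards [ae_restrict_of_ae hne, ae_restrict_mem measurableSet_Ioi] with x hx hx0
    rw [thetaRemainder_eq hx0 hx]
  refine ⟨Integrable.congr hs2.1 hae, ?_⟩
  have hval := hs2.2
  rw [hs1.2, hm1.2, hm2.2] at hval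
  rw [mellin, ← integral_congr_ae hae]
  refine hval.trans ?_
  have e1 : mellin (hurwitzEvenFEPair 0).toStrongFEPair.f u = (hurwitzEvenFEPair 0).Λ₀ u := rfl
  rw [e1, completedRiemannZeta, completedHurwitzZetaEven, WeakFEPair.Λ]
  rw [show 2 * u / 2 = u by ring]
  have e2 : (1 / 2 : ℂ) - u ≠ 0 := fun h => by
    have := congrArg Complex.re h
    simp at this; norm_num at h1; linarith
  have e3 : u + -(1 / 2) ≠ 0 := fun h => e2 (by linear_combination -h)
  have e4 : -1 / (u + -(1 / 2)) = 1 / (1 / 2 - u) := by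
    rw [div_eq_div_iff e3 e2]; ring
  simp only [hurwitzEvenFEPair, if_true, smul_eq_mul, mul_one, e4]
  push_cast
  ring

theorem integral_critZeta :
    ∫ v, critZeta v = (Real.pi * (evenKernel 0 1 - 2) : ℝ) := by
  have hval : ∀ y : ℝ, mellin thetaRemainder (((1 / 4 : ℝ) : ℂ) + y * I) = 2 * critZeta y := by
    intro y
    rw [(hasMellin_thetaRemainder (by simp) (by norm_num)).2, critZeta]
    congr 2; push_cast; ring
  have hc : ContinuousAt thetaRemainder 1 := by
    have h1 : ContinuousAt (evenKernel 0) 1 :=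
      (continuousOn_evenKernel 0).continuousAt (Ioi_mem_nhds one_pos)
    have h2 : ContinuousAt (fun x : ℝ => (x : ℂ) ^ (-(1 / 2) : ℂ)) 1 :=
      continuousAt_ofReal_cpow_const _ _ (Or.inr one_ne_zero)
    exact ((continuous_ofReal.continuousAt.comp h1).sub continuousAt_const).sub h2
  have h := mellinInv_mellin_eq (1 / 4) thetaRemainder one_pos
    (hasMellin_thetaRemainder (by norm_num) (by norm_num)).1
    (by simpa only [VerticalIntegrable, hval] using integrable_critZeta.const_mul 2) hc
  simp only [mellinInv, hval, ofReal_one, one_cpow, one_smul] at h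
  rw [integral_const_mul, real_smul, thetaRemainder, ofReal_one, one_cpow] at h
  have hpi : (Real.pi : ℂ) ≠ 0 := ofReal_ne_zero.mpr Real.pi_ne_zero
  push_cast at h ⊢
  field_simp at h
  linear_combination h

end Inversion

/-! ### Duplication formulas for theta series. -/

section ThetaDuplication
open Set HurwitzZeta

/-- The weight is 2 on pairs of even sum and 0 elsewhere, and (j, k) ↦ (j + k, j - k) parametrizes
those pairs bijectively. -/
lemma tsum_parity_eq (F : ℤ × ℤ → ℝ) :
    ∑' p : ℤ × ℤ, (1 + (-1 : ℝ) ^ (p.1 + p.2)) * F p =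
      2 * ∑' p : ℤ × ℤ, F (p.1 + p.2, p.1 - p.2) := by
  let φ : ℤ × ℤ → ℤ × ℤ := fun p => (p.1 + p.2, p.1 - p.2)
  have hφ : Function.Injective φ := by
    rintro ⟨a, b⟩ ⟨c, d⟩ h
    simp only [φ, Prod.mk.injEq] at h ⊢
    omega
  have hs : Function.support (fun p : ℤ × ℤ => (1 + (-1 : ℝ) ^ (p.1 + p.2)) * F p) ⊆ range φ := by
    rintro ⟨m, n⟩ h
    rcases Int.even_or_odd (m + n) with he | ho
    · obtain ⟨j, hj⟩ := he
      exact ⟨(j, m - j), by simp only [φ, Prod.mk.injEq]; omega⟩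
    · exact absurd (by simp [ho.neg_one_zpow]) h
  rw [← hφ.tsum_eq hs, ← tsum_mul_left]
  refine tsum_congr fun p => ?_
  have : Even ((φ p).1 + (φ p).2) := ⟨p.1, by simp only [φ]; ring⟩
  rw [this.neg_one_zpow]
  norm_num [φ]

/-- The terms of the theta series at `i t`. -/
noncomputable def thetaTerm (t : ℝ) (n : ℤ) : ℝ := Real.exp (-Real.pi * n ^ 2 * t)

/-- The theta series with alternating signs. -/
noncomputable def altTheta (t : ℝ) : ℝ := ∑' n : ℤ, (-1 : ℝ) ^ n * thetaTerm t n

lemma hasSum_thetaTerm {t : ℝ} (ht : 0 < t) : HasSum (thetaTerm t) (evenKernel 0 t) := by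
  simpa [funext (f := thetaTerm t) fun n => thetaTerm.eq_1 t n] using hasSum_int_evenKernel 0 ht

lemma thetaTerm_pos (t : ℝ) (n : ℤ) : 0 < thetaTerm t n := Real.exp_pos _

lemma summable_norm_thetaTerm {t : ℝ} (ht : 0 < t) : Summable fun n => ‖thetaTerm t n‖ := by
  simpa only [Real.norm_of_nonneg (thetaTerm_pos t _).le] using (hasSum_thetaTerm ht).summable

lemma summable_norm_alt {t : ℝ} (ht : 0 < t) :
    Summable fun n : ℤ => ‖(-1 : ℝ) ^ n * thetaTerm t n‖ := by
  simpa only [norm_mul, Real.norm_eq_abs, abs_neg_one_zpow, one_mul] using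
    summable_norm_thetaTerm ht

/-- The parallelogram identity (j+k)² + (j-k)² = 2j² + 2k² is the source of both duplication
formulas. -/
lemma thetaTerm_mul (t : ℝ) (j k : ℤ) :
    thetaTerm t (j + k) * thetaTerm t (j - k) = thetaTerm (2 * t) j * thetaTerm (2 * t) k := by
  simp only [thetaTerm, ← Real.exp_add]
  congr 1; push_cast; ring

lemma evenKernel_sq_add_altTheta_sq {t : ℝ} (ht : 0 < t) :
    evenKernel 0 t ^ 2 + altTheta t ^ 2 = 2 * evenKernel 0 (2 * t) ^ 2 := by
  have h2t : 0 < 2 * t := by linarith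
  have h1 := summable_norm_thetaTerm ht
  have h2 := summable_norm_alt ht
  have h3 := summable_norm_thetaTerm h2t
  rw [← (hasSum_thetaTerm ht).tsum_eq, ← (hasSum_thetaTerm h2t).tsum_eq, altTheta, sq, sq, sq,
    tsum_mul_tsum_of_summable_norm h1 h1, tsum_mul_tsum_of_summable_norm h2 h2,
    tsum_mul_tsum_of_summable_norm h3 h3,
    ← (summable_mul_of_summable_norm h1 h1).tsum_add (summable_mul_of_summable_norm h2 h2)]
  have := tsum_parity_eq fun p => thetaTerm t p.1 * thetaTerm t p.2
  simp only [thetaTerm_mul] at this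
  rw [← this]
  refine tsum_congr fun p => ?_
  rw [zpow_add₀ (by norm_num)]
  ring

lemma evenKernel_mul_altTheta {t : ℝ} (ht : 0 < t) :
    evenKernel 0 t * altTheta t = altTheta (2 * t) ^ 2 := by
  have h2t : 0 < 2 * t := by linarith
  have h1 := summable_norm_thetaTerm ht
  have h2 := summable_norm_alt ht
  have h3 := summable_norm_alt h2t
  have e1 := tsum_mul_tsum_of_summable_norm h1 h2
  have e2 := tsum_mul_tsum_of_summable_norm h2 h1
  have e3 := tsum_mul_tsum_of_summable_norm h3 h3
  have := tsum_parity_eq fun p => (-1 : ℝ) ^ p.1 * (thetaTerm t p.1 * thetaTerm t p.2)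
  simp only [thetaTerm_mul] at this
  have e4 : ∑' p : ℤ × ℤ, (-1 : ℝ) ^ (p.1 + p.2) *
      (thetaTerm (2 * t) p.1 * thetaTerm (2 * t) p.2) = altTheta (2 * t) ^ 2 := by
    rw [sq, altTheta, e3]
    refine tsum_congr fun p => ?_
    rw [zpow_add₀ (by norm_num)]; ring
  have e5 : ∑' p : ℤ × ℤ, (1 + (-1 : ℝ) ^ (p.1 + p.2)) *
      ((-1 : ℝ) ^ p.1 * (thetaTerm t p.1 * thetaTerm t p.2)) =
      evenKernel 0 t * altTheta t + altTheta t * evenKernel 0 t := by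
    rw [← (hasSum_thetaTerm ht).tsum_eq, altTheta, e1, e2,
      ← (summable_mul_of_summable_norm h1 h2).tsum_add (summable_mul_of_summable_norm h2 h1)]
    refine tsum_congr fun p => ?_
    have hs : (-1 : ℝ) ^ p.1 * (-1 : ℝ) ^ p.1 = 1 := by
      rw [← mul_zpow]; norm_num
    rw [zpow_add₀ (by norm_num)]
    linear_combination (-1 : ℝ) ^ p.2 * (thetaTerm t p.1 * thetaTerm t p.2) * hs
  rw [e4, e5] at this
  linarith

lemma one_le_evenKernel {t : ℝ} (ht : 0 < t) : 1 ≤ evenKernel 0 t := by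
  have := (hasSum_thetaTerm ht).summable.le_tsum 0 fun n _ => (thetaTerm_pos t n).le
  rw [(hasSum_thetaTerm ht).tsum_eq] at this
  simpa [thetaTerm] using this

lemma tendsto_evenKernel_atTop : Tendsto (evenKernel 0) atTop (𝓝 1) := by
  obtain ⟨p, hp, h⟩ := isBigO_atTop_evenKernel_sub 0
  have h2 : Tendsto (fun x : ℝ => Real.exp (-p * x)) atTop (𝓝 0) := by
    refine Real.tendsto_exp_atBot.comp ?_
    exact tendsto_id.const_mul_atTop_of_neg (by linarith)
  have h3 := h.trans_tendsto h2
  simpa using h3.add_const 1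

lemma evenKernel_half_sq : evenKernel 0 (1 / 2) ^ 2 = 2 * evenKernel 0 2 ^ 2 := by
  rw [evenKernel_functional_equation 0 (1 / 2), evenKernel_eq_cosKernel_of_zero, one_div_one_div,
    mul_pow, ← Real.sqrt_eq_rpow, div_pow, Real.sq_sqrt (by norm_num)]
  norm_num

/-- Let a, b be the two squares at t = 1 and P = θ(1/2)². Duplication at 1 and inversion give a + b
= P; duplication at 1/2 gives b² = P(2a - P) = (a + b)(a - b). -/
lemma evenKernel_one_pow_four : (evenKernel 0 1 ^ 2) ^ 2 = 2 * (altTheta 1 ^ 2) ^ 2 := by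
  have h1 := evenKernel_sq_add_altTheta_sq (t := 1) one_pos
  have h2 := evenKernel_sq_add_altTheta_sq (t := 1 / 2) (by norm_num)
  have h3 := evenKernel_mul_altTheta (t := 1 / 2) (by norm_num)
  have h4 := evenKernel_half_sq
  norm_num at h1 h2 h3 h4
  rw [← h3]
  have h5 : evenKernel 0 1 ^ 2 + evenKernel 0 (1 / 2) * altTheta (1 / 2) =
      evenKernel 0 (1 / 2) ^ 2 := by linarith
  have h6 : altTheta (1 / 2) ^ 2 = 2 * evenKernel 0 1 ^ 2 - evenKernel 0 (1 / 2) ^ 2 := by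
    linarith
  have h7 : (evenKernel 0 (1 / 2) * altTheta (1 / 2)) ^ 2 =
      evenKernel 0 (1 / 2) ^ 2 * (2 * evenKernel 0 1 ^ 2 - evenKernel 0 (1 / 2) ^ 2) := by
    rw [mul_pow, h6]
  rw [← h5] at h7
  linear_combination -h7

end ThetaDuplication

/-! ### The AGM, the lemniscatic integral and the value of θ(1). -/

section GaussIntegral
open Set HurwitzZeta

/-- The integrand of the complete elliptic integral in Gauss's form. -/
noncomputable def agmIntegrand (a b x : ℝ) : ℝ := (√((x ^ 2 + a ^ 2) * (x ^ 2 + b ^ 2)))⁻¹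

/-- The complete elliptic integral in Gauss's form. -/
noncomputable def agmIntegral (a b : ℝ) : ℝ := ∫ x, agmIntegrand a b x

lemma agmIntegral_eq_two_mul (a b : ℝ) :
    agmIntegral a b = 2 * ∫ x in Ioi (0 : ℝ), agmIntegrand a b x := by
  rw [← integral_comp_abs, agmIntegral]
  simp [agmIntegrand]

/-- The substitution x ↦ (x - ab/x)/2 maps (0, ∞) bijectively onto ℝ and turns one integrand into
twice the other. -/
lemma agmIntegral_agm {a b c : ℝ} (ha : 0 < a) (hb : 0 < b) (hc : c ^ 2 = a * b) :
    agmIntegral ((a + b) / 2) c = agmIntegral a b := by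
  have hab : 0 < a * b := mul_pos ha hb
  let f : ℝ → ℝ := fun x => (x - a * b * x⁻¹) / 2
  let f' : ℝ → ℝ := fun x => (1 + a * b * (x ^ 2)⁻¹) / 2
  have hf' : ∀ x ∈ Ioi (0 : ℝ), HasDerivWithinAt f (f' x) (Ioi 0) x := by
    intro x hx
    have h := (((hasDerivAt_id' x).sub ((hasDerivAt_inv (ne_of_gt hx)).const_mul (a * b))).div_const
      2).hasDerivWithinAt (s := Ioi 0)
    convert! h using 1
    simp only [f']; ring
  have hinj : InjOn f (Ioi 0) := by
    intro x hx y hy h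
    have hx : 0 < x := hx
    have hy : 0 < y := hy
    simp only [f] at h
    have h2 : (x - y) * (x * y + a * b) = 0 := by
      field_simp at h
      linear_combination h
    rcases mul_eq_zero.mp h2 with h | h
    · linarith
    · nlinarith [mul_pos hx hy]
  have himg : f '' Ioi 0 = univ := by
    refine eq_univ_of_forall fun y => ?_
    have hs : 0 ≤ y ^ 2 + a * b := by positivity
    have hlt : |y| < √(y ^ 2 + a * b) := by
      rw [← Real.sqrt_sq_eq_abs]
      exact Real.sqrt_lt_sqrt (sq_nonneg y) (by linarith)
    have hpos : 0 < y + √(y ^ 2 + a * b) := by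
      have := neg_abs_le y
      linarith
    -- The positive root of x² - 2yx - ab = 0.
    refine ⟨y + √(y ^ 2 + a * b), hpos, ?_⟩
    simp only [f]
    field_simp
    nlinarith [Real.sq_sqrt hs]
  have hmain := integral_image_eq_integral_abs_deriv_smul measurableSet_Ioi hf' hinj
    (agmIntegrand ((a + b) / 2) c)
  rw [himg, Measure.restrict_univ] at hmain
  rw [agmIntegral_eq_two_mul a b, agmIntegral, hmain, ← integral_const_mul]
  refine setIntegral_congr_fun measurableSet_Ioi fun x hx => ?_
  have hx : 0 < x := hx
  have hpos : 0 < f' x := by simp only [f']; positivity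
  have key : (f x ^ 2 + ((a + b) / 2) ^ 2) * (f x ^ 2 + c ^ 2) =
      (f' x / 2) ^ 2 * ((x ^ 2 + a ^ 2) * (x ^ 2 + b ^ 2)) := by
    rw [hc]
    simp only [f, f']
    field_simp
    ring
  simp only [agmIntegrand, key, smul_eq_mul]
  rw [Real.sqrt_mul (sq_nonneg _), Real.sqrt_sq (by positivity), abs_of_pos hpos, mul_inv]
  field_simp

lemma agmIntegral_smul {c : ℝ} (hc : 0 < c) (a b : ℝ) :
    agmIntegral (c * a) (c * b) = c⁻¹ * agmIntegral a b := by
  have h := Measure.integral_comp_mul_left (agmIntegrand (c * a) (c * b)) c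
  have h2 : ∀ x, agmIntegrand (c * a) (c * b) (c * x) = (c ^ 2)⁻¹ * agmIntegrand a b x := by
    intro x
    have : ((c * x) ^ 2 + (c * a) ^ 2) * ((c * x) ^ 2 + (c * b) ^ 2) =
      (c ^ 2) ^ 2 * ((x ^ 2 + a ^ 2) * (x ^ 2 + b ^ 2)) := by ring
    rw [agmIntegrand, this, Real.sqrt_mul (sq_nonneg _), Real.sqrt_sq (by positivity), mul_inv,
      agmIntegrand]
  simp only [h2] at h
  rw [integral_const_mul, smul_eq_mul, abs_of_pos (inv_pos.mpr hc)] at h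
  rw [agmIntegral, agmIntegral]
  field_simp at h ⊢
  linarith

lemma agmIntegral_one_one : agmIntegral 1 1 = Real.pi := by
  rw [agmIntegral, ← integral_univ_inv_one_add_sq]
  congr 1; ext x
  rw [agmIntegrand, ← sq, Real.sqrt_sq (by positivity)]
  ring

lemma tendsto_agmIntegral {a b : ℕ → ℝ} (ha : Tendsto a atTop (𝓝 1)) (hb : Tendsto b atTop (𝓝 1)) :
    Tendsto (fun n => agmIntegral (a n) (b n)) atTop (𝓝 Real.pi) := by
  rw [← agmIntegral_one_one]
  -- Once both parameters exceed 1/2, each factor under the root is at least (1 + x²)/4.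
  refine tendsto_integral_filter_of_dominated_convergence (fun x => 4 * (1 + x ^ 2)⁻¹)
    (Eventually.of_forall fun n => ?_) ?_ (integrable_inv_one_add_sq.const_mul 4)
    (Eventually.of_forall fun x => ?_)
  · refine Measurable.aestronglyMeasurable ?_
    unfold agmIntegrand
    fun_prop
  · filter_upwards [ha.eventually (lt_mem_nhds (show (1 / 2 : ℝ) < 1 by norm_num)),
      hb.eventually (lt_mem_nhds (show (1 / 2 : ℝ) < 1 by norm_num))] with n h1 h2
    refine Eventually.of_forall fun x => ?_
    have hm : ((1 + x ^ 2) / 4) ^ 2 ≤ (x ^ 2 + a n ^ 2) * (x ^ 2 + b n ^ 2) := by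
      rw [sq]
      gcongr <;> nlinarith [sq_nonneg x]
    have hs := Real.sqrt_le_sqrt hm
    rw [Real.sqrt_sq (by positivity)] at hs
    rw [agmIntegrand, norm_inv, Real.norm_of_nonneg (Real.sqrt_nonneg _)]
    calc _ ≤ ((1 + x ^ 2) / 4)⁻¹ := by gcongr
      _ = _ := by rw [inv_div, div_eq_mul_inv]
  · unfold agmIntegrand
    refine Tendsto.inv₀ ?_ (by positivity)
    refine (Real.continuous_sqrt.tendsto _).comp ?_
    exact (tendsto_const_nhds.add (ha.pow 2)).mul (tendsto_const_nhds.add (hb.pow 2))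

lemma agmIntegral_theta :
    agmIntegral (evenKernel 0 1 ^ 2) (altTheta 1 ^ 2) = Real.pi := by
  -- Positivity travels with the induction because the AGM step needs it; it starts from the ratio
  -- at t = 1.
  have hpos : ∀ n : ℕ, 0 < altTheta (2 ^ n) ^ 2 ∧
      agmIntegral (evenKernel 0 (2 ^ n) ^ 2) (altTheta (2 ^ n) ^ 2) =
      agmIntegral (evenKernel 0 1 ^ 2) (altTheta 1 ^ 2) := by
    intro n
    induction n with
    | zero =>
      refine ⟨?_, by simp⟩
      have h1 := evenKernel_one_pow_four
      have h2 := one_le_evenKernel (t := 1) one_pos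
      simp only [pow_zero]
      refine lt_of_le_of_ne (sq_nonneg _) fun h => ?_
      rw [← h] at h1
      have : 0 < (evenKernel 0 1 ^ 2) ^ 2 := by positivity
      norm_num at h1
      linarith
    | succ n ih =>
      obtain ⟨hp, hI⟩ := ih
      have h2n : (0 : ℝ) < 2 ^ n := by positivity
      have hk : 0 < evenKernel 0 (2 ^ n) := by linarith [one_le_evenKernel h2n]
      have hadd := evenKernel_sq_add_altTheta_sq h2n
      have hmul := evenKernel_mul_altTheta h2n
      have hsq : (altTheta (2 ^ (n + 1)) ^ 2) ^ 2 =
          evenKernel 0 (2 ^ n) ^ 2 * altTheta (2 ^ n) ^ 2 := by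
        rw [pow_succ' 2 n, ← hmul, mul_pow]
      refine ⟨?_, ?_⟩
      · refine lt_of_le_of_ne (sq_nonneg _) fun h => ?_
        rw [← h] at hsq
        have : 0 < evenKernel 0 (2 ^ n) ^ 2 * altTheta (2 ^ n) ^ 2 := by positivity
        norm_num at hsq
        rcases hsq with h | h <;> simp [h] at this
      · rw [← hI, ← agmIntegral_agm (by positivity) hp hsq, hadd, pow_succ' 2 n]
        congr 1; ring
  have h2 : Tendsto (fun n : ℕ => (2 : ℝ) ^ n) atTop atTop :=
    tendsto_pow_atTop_atTop_of_one_lt one_lt_two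
  have hA : Tendsto (fun n : ℕ => evenKernel 0 ((2 : ℝ) ^ n) ^ 2) atTop (𝓝 1) := by
    simpa using (tendsto_evenKernel_atTop.comp h2).pow 2
  have hB : Tendsto (fun n : ℕ => altTheta ((2 : ℝ) ^ n) ^ 2) atTop (𝓝 1) := by
    have h := ((hA.comp (tendsto_add_atTop_nat 1)).const_mul 2).sub hA
    norm_num at h
    refine h.congr fun n => ?_
    have := evenKernel_sq_add_altTheta_sq (t := (2 : ℝ) ^ n) (by positivity)
    simp only [pow_succ' (2 : ℝ) n]
    linarith
  have hlim := tendsto_agmIntegral hA hB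
  simp only [(hpos _).2] at hlim
  exact tendsto_nhds_unique tendsto_const_nhds hlim

lemma betaIntegral_quarter_half : betaIntegral (1 / 4) (1 / 2) =
    ((∫ y in Ioo (0 : ℝ) 1, y ^ (-(3 / 4) : ℝ) * (1 - y) ^ (-(1 / 2) : ℝ) : ℝ) : ℂ) := by
  unfold betaIntegral
  rw [intervalIntegral.integral_of_le zero_le_one, integral_Ioc_eq_integral_Ioo,
    ← integral_complex_ofReal]
  refine setIntegral_congr_fun measurableSet_Ioo fun y hy => ?_
  rw [ofReal_mul, ofReal_cpow hy.1.le, ofReal_cpow (by linarith [hy.2])]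
  push_cast
  norm_num

/-- The substitution y = (1 + x²)⁻² produces the integrand of B(1/4, 1/2). -/
lemma agmIntegral_sqrt_two_eq_integral : agmIntegral √2 1 =
    (1 / 2) * ∫ y in Ioo (0 : ℝ) 1, y ^ (-(3 / 4) : ℝ) * (1 - y) ^ (-(1 / 2) : ℝ) := by
  let f : ℝ → ℝ := fun x => ((1 + x ^ 2) ^ 2)⁻¹
  let f' : ℝ → ℝ := fun x => -(4 * x * ((1 + x ^ 2) ^ 3)⁻¹)
  have hf' : ∀ x ∈ Ioi (0 : ℝ), HasDerivWithinAt f (f' x) (Ioi 0) x := by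
    intro x hx
    have h1 : HasDerivAt (fun x : ℝ => (1 + x ^ 2) ^ 2) (2 * (1 + x ^ 2) * (2 * x)) x := by
      convert! (((hasDerivAt_id' x).pow 2).const_add 1).pow 2 using 1
      simp
    have h2 := (h1.inv (by positivity)).hasDerivWithinAt (s := Ioi 0)
    convert! h2 using 1
    simp only [f']
    field_simp
    ring
  have hinj : InjOn f (Ioi 0) := by
    intro x hx y hy h
    have hx : 0 < x := hx
    have hy : 0 < y := hy
    have h1 := inv_injective h
    have h2 := (pow_left_inj₀ (by positivity) (by positivity) two_ne_zero).mp h1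
    exact (pow_left_inj₀ hx.le hy.le two_ne_zero).mp (by linarith)
  have himg : f '' Ioi 0 = Ioo 0 1 := by
    ext y
    constructor
    · rintro ⟨x, hx, rfl⟩
      have hx : 0 < x := hx
      refine ⟨by simp only [f]; positivity, inv_lt_one_of_one_lt₀ ?_⟩
      nlinarith [pow_pos hx 2]
    · rintro ⟨h0, h1⟩
      have hs : 1 < (√y)⁻¹ := by
        refine (one_lt_inv₀ (Real.sqrt_pos.mpr h0)).mpr ?_
        rw [Real.sqrt_lt' one_pos]; simpa using h1
      refine ⟨√((√y)⁻¹ - 1), Real.sqrt_pos.mpr (by linarith), ?_⟩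
      simp only [f]
      rw [Real.sq_sqrt (by linarith), add_sub_cancel, inv_pow, inv_inv, Real.sq_sqrt h0.le]
  have hmain := integral_image_eq_integral_abs_deriv_smul measurableSet_Ioi hf' hinj
    (fun y => y ^ (-(3 / 4) : ℝ) * (1 - y) ^ (-(1 / 2) : ℝ))
  rw [himg] at hmain
  rw [agmIntegral_eq_two_mul, hmain, ← integral_const_mul, ← integral_const_mul]
  refine setIntegral_congr_fun measurableSet_Ioi fun x hx => ?_
  have hx : 0 < x := hx
  have hw : 0 < 1 + x ^ 2 := by positivity
  have hw' : 0 < x ^ 2 + 2 := by positivity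
  have e1 : (f x) ^ (-(3 / 4) : ℝ) = (1 + x ^ 2) * √(1 + x ^ 2) := by
    simp only [f]
    rw [Real.inv_rpow (by positivity), Real.rpow_neg (by positivity), inv_inv, ← Real.rpow_natCast,
      ← Real.rpow_mul hw.le, Real.sqrt_eq_rpow]
    nth_rw 2 [← Real.rpow_one (1 + x ^ 2)]
    rw [← Real.rpow_add hw]
    norm_num
  have e2 : (1 - f x) ^ (-(1 / 2) : ℝ) = (1 + x ^ 2) * (x * √(x ^ 2 + 2))⁻¹ := by
    have : 1 - f x = x ^ 2 * (x ^ 2 + 2) / (1 + x ^ 2) ^ 2 := by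
      simp only [f]
      field_simp
      ring
    rw [Real.rpow_neg (by rw [this]; positivity), ← Real.sqrt_eq_rpow, this,
      Real.sqrt_div (by positivity), Real.sqrt_mul (by positivity), Real.sqrt_sq hx.le,
      Real.sqrt_sq hw.le, inv_div, div_eq_mul_inv]
  have e3 : agmIntegrand √2 1 x = (√(x ^ 2 + 2))⁻¹ * (√(1 + x ^ 2))⁻¹ := by
    rw [agmIntegrand, Real.sq_sqrt (by norm_num), Real.sqrt_mul hw'.le, mul_inv, one_pow,
      add_comm (x ^ 2) 1]
  have e4 : |f' x| = 4 * x * ((1 + x ^ 2) ^ 3)⁻¹ := by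
    simp only [f']
    rw [abs_neg, abs_of_pos (by positivity)]
  simp only [smul_eq_mul, e1, e2, e3, e4]
  have hs := Real.sq_sqrt hw.le
  have hs0 := Real.sqrt_pos.mpr hw
  have hs1 := Real.sqrt_pos.mpr hw'
  field_simp
  rw [hs]
  ring

lemma agmIntegral_sqrt_two :
    agmIntegral √2 1 * Real.Gamma (3 / 4) ^ 2 = √2 * Real.pi * √Real.pi / 2 := by
  rw [agmIntegral_sqrt_two_eq_integral]
  set B := ∫ y in Ioo (0 : ℝ) 1, y ^ (-(3 / 4) : ℝ) * (1 - y) ^ (-(1 / 2) : ℝ)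
  have h := Gamma_mul_Gamma_eq_betaIntegral (s := 1 / 4) (t := 1 / 2) (by norm_num) (by norm_num)
  have h1 : Real.Gamma (1 / 4) * √Real.pi = Real.Gamma (3 / 4) * B := by
    rw [betaIntegral_quarter_half] at h
    rw [← Real.Gamma_one_half_eq]
    have c1 : (1 / 4 : ℂ) = ((1 / 4 : ℝ) : ℂ) := by push_cast; rfl
    have c2 : (1 / 2 : ℂ) = ((1 / 2 : ℝ) : ℂ) := by push_cast; rfl
    rw [c1, c2, ← ofReal_add, Gamma_ofReal, Gamma_ofReal, Gamma_ofReal] at h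
    norm_num at h
    norm_num
    exact_mod_cast h
  -- Reflection eliminates Γ(1/4) in favour of Γ(3/4).
  have h2 := Real.Gamma_mul_Gamma_one_sub (1 / 4)
  rw [show Real.pi * (1 / 4) = Real.pi / 4 by ring, Real.sin_pi_div_four,
    show (1 - 1 / 4 : ℝ) = 3 / 4 by norm_num] at h2
  have h3 : Real.pi / (√2 / 2) = √2 * Real.pi := by
    have := Real.sq_sqrt (show (0 : ℝ) ≤ 2 by norm_num)
    field_simp
    linarith
  rw [h3] at h2
  linear_combination (-Real.Gamma (3 / 4) / 2) * h1 + (√Real.pi / 2) * h2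

theorem evenKernel_zero_one : evenKernel 0 1 = Real.pi ^ (1 / 4 : ℝ) / Real.Gamma (3 / 4) := by
  have hG : 0 < Real.Gamma (3 / 4) := Real.Gamma_pos_of_pos (by norm_num)
  have h1 := one_le_evenKernel (t := 1) one_pos
  set a := evenKernel 0 1 ^ 2 with ha
  set b := altTheta 1 ^ 2 with hb
  have hab : a = b * √2 := by
    have h := evenKernel_one_pow_four
    rw [← ha, ← hb] at h
    have hb0 : 0 ≤ b := sq_nonneg _
    refine (pow_left_inj₀ (sq_nonneg _) (by positivity) two_ne_zero).mp ?_
    rw [mul_pow, Real.sq_sqrt (by norm_num), h]; ring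
  have hb0 : 0 < b := by
    have : 0 < a := by positivity
    rw [hab] at this
    exact pos_of_mul_pos_left this (Real.sqrt_nonneg _)
  have h2 : b⁻¹ * agmIntegral √2 1 = Real.pi := by
    rw [← agmIntegral_theta, ← agmIntegral_smul hb0, mul_one, ← hab]
  have h3 := agmIntegral_sqrt_two
  have h4 : agmIntegral √2 1 = Real.pi * b := by
    field_simp at h2; linarith
  rw [h4] at h3
  have h5 : a * Real.Gamma (3 / 4) ^ 2 = √Real.pi := by
    have hs := Real.sq_sqrt (show (0 : ℝ) ≤ 2 by norm_num)
    have hpi := Real.pi_pos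
    have : Real.pi * (a * Real.Gamma (3 / 4) ^ 2) = Real.pi * √Real.pi := by
      rw [hab]
      linear_combination √2 * h3 + (Real.pi * √Real.pi / 2) * hs
    exact mul_left_cancel₀ hpi.ne' this
  rw [eq_div_iff hG.ne']
  refine (pow_left_inj₀ (by positivity) (by positivity) two_ne_zero).mp ?_
  rw [mul_pow, ← ha, h5, Real.sqrt_eq_rpow, ← Real.rpow_natCast, ← Real.rpow_mul Real.pi_pos.le]
  norm_num

theorem integral_critZeta_eq_cstVal :
    ∫ v, critZeta v = -(2 * Real.pi * (cstVal : ℂ)) := by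
  rw [integral_critZeta, evenKernel_zero_one, cstVal]
  push_cast
  ring

end GaussIntegral

/-! ### Principal values and odd functions. -/

section PrincipalValue
open Set

lemma measurableSet_excised {S : Set ℝ} (hS : S.Finite) (ε : ℝ) : MeasurableSet (excised S ε) := by
  have : excised S ε = ⋂ a ∈ S, {v | ε < |v - a|} := by ext v; simp [excised]
  rw [this]
  exact hS.measurableSet_biInter fun a _ =>
    measurableSet_lt measurable_const (measurable_id.sub_const a).abs

lemma notMem_of_mem_excised {S : Set ℝ} {ε v : ℝ} (hε : 0 < ε) (hv : v ∈ excised S ε) : v ∉ S :=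
  fun h => by
    have := hv v h
    simp at this
    linarith

lemma excised_empty (ε : ℝ) : excised ∅ ε = univ := by ext; simp [excised]

lemma HasPV.integrable {f : ℝ → ℂ} {L : ℂ} (h : HasPV f ∅ L) : Integrable f := by
  simpa [excised_empty] using h.1 1 one_pos

lemma HasPV.integral_eq {f : ℝ → ℂ} {L : ℂ} (h : HasPV f ∅ L) : ∫ v, f v = L := by
  have := h.2
  simp only [excised_empty, Measure.restrict_univ] at this
  exact tendsto_nhds_unique tendsto_const_nhds this

lemma HasPV.pvIntegral_eq {f : ℝ → ℂ} {S : Set ℝ} {L : ℂ} (h : HasPV f S L) :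
    pvIntegral f S = L := h.2.limUnder_eq

lemma HasPV.congr {f g : ℝ → ℂ} {S : Set ℝ} {L : ℂ} (hS : S.Finite) (hf : HasPV f S L)
    (h : ∀ v ∉ S, f v = g v) : HasPV g S L := by
  have he : ∀ ε > 0, EqOn f g (excised S ε) := fun ε hε v hv => h v (notMem_of_mem_excised hε hv)
  refine ⟨fun ε hε => (hf.1 ε hε).congr_fun (he ε hε) (measurableSet_excised hS ε), ?_⟩
  refine hf.2.congr' ?_
  filter_upwards [self_mem_nhdsWithin] with ε hε
  exact setIntegral_congr_fun (measurableSet_excised hS ε) (he ε hε)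

lemma HasPV.add {f g : ℝ → ℂ} {S : Set ℝ} {L M : ℂ} (hf : HasPV f S L) (hg : HasPV g S M) :
    HasPV (fun v => f v + g v) S (L + M) := by
  refine ⟨fun ε hε => (hf.1 ε hε).add (hg.1 ε hε), (hf.2.add hg.2).congr' ?_⟩
  filter_upwards [self_mem_nhdsWithin] with ε hε
  exact (integral_add (hf.1 ε hε) (hg.1 ε hε)).symm

lemma HasPV.const_mul {f : ℝ → ℂ} {S : Set ℝ} {L : ℂ} (hf : HasPV f S L) (c : ℂ) :
    HasPV (fun v => c * f v) S (c * L) := by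
  refine ⟨fun ε hε => (hf.1 ε hε).const_mul c, ?_⟩
  simpa only [integral_const_mul] using hf.2.const_mul c

lemma hasPV_of_integrable {f : ℝ → ℂ} {S : Set ℝ} (hS : S.Finite) (hf : Integrable f) :
    HasPV f S (∫ v, f v) := by
  refine ⟨fun ε _ => hf.integrableOn, ?_⟩
  simp_rw [← integral_indicator (measurableSet_excised hS _)]
  refine tendsto_integral_filter_of_dominated_convergence (fun v => ‖f v‖)
    (Eventually.of_forall fun ε => (hf.indicator (measurableSet_excised hS ε)).aestronglyMeasurable)
    (Eventually.of_forall fun ε => Eventually.of_forall fun v => norm_indicator_le_norm_self _ _)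
    hf.norm ?_
  have h0 : ∀ᵐ v : ℝ, v ∉ S := measure_eq_zero_iff_ae_notMem.mp (hS.measure_zero volume)
  filter_upwards [h0] with v hv
  have hev : ∀ᶠ ε : ℝ in 𝓝[>] 0, v ∈ excised S ε := by
    refine (hS.eventually_all).mpr fun a ha => ?_
    have : 0 < |v - a| := abs_pos.mpr (sub_ne_zero.mpr fun h => hv (h ▸ ha))
    exact eventually_nhdsWithin_of_eventually_nhds (gt_mem_nhds this)
  refine tendsto_const_nhds.congr' ?_
  filter_upwards [hev] with ε hε
  rw [indicator_of_mem hε]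

/-- The excised line is symmetric, so the integral is zero for every ε, before any limit. Hence the
order of the poles is irrelevant, which matters for the squared denominator of K_s. -/
lemma hasPV_of_odd {f : ℝ → ℂ} {S : Set ℝ} (hS : S.Finite) (hneg : ∀ a ∈ S, -a ∈ S)
    (hodd : ∀ v, f (-v) = -f v) (hf : ∀ ε > 0, IntegrableOn f (excised S ε)) : HasPV f S 0 := by
  refine ⟨hf, tendsto_const_nhds.congr fun ε => ?_⟩
  have hmem : ∀ v, v ∈ excised S ε → -v ∈ excised S ε := by
    intro v hv a ha
    have := hv (-a) (hneg a ha)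
    rwa [show -v - a = -(v - -a) by ring, abs_neg]
  have hind : ∀ v, (excised S ε).indicator f (-v) = -(excised S ε).indicator f v := by
    intro v
    by_cases h : v ∈ excised S ε
    · rw [indicator_of_mem h, indicator_of_mem (hmem v h), hodd]
    · rw [indicator_of_notMem h, indicator_of_notMem fun h' => h (by simpa using hmem _ h'),
        neg_zero]
  rw [← integral_indicator (measurableSet_excised hS ε)]
  have h1 := integral_neg_eq_self ((excised S ε).indicator f) volume
  simp only [hind, integral_neg] at h1
  exact (self_eq_neg.mp h1.symm).symm

end PrincipalValue

/-! ### Even and odd parts of the integrands. -/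

section Kernel
open Set

lemma kernelDen_eq_mul (s : ℂ) (v : ℝ) :
    kernelDen s v = 2 * ((v + I * ((2 * s - 1) / 4)) * (v - I * ((2 * s - 1) / 4))) := by
  rw [kernelDen]
  linear_combination ((2 * s - 1) ^ 2 / 8) * I_sq

lemma kernelDen_neg (s : ℂ) (v : ℝ) : kernelDen s (-v) = kernelDen s v := by
  simp [kernelDen]

lemma neg_mem_kernelPoles (s : ℂ) : ∀ a ∈ kernelPoles s, -a ∈ kernelPoles s := by
  intro a ha
  rwa [kernelPoles, mem_ofPred_eq, kernelDen_neg]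

lemma finite_kernelPoles (s : ℂ) : (kernelPoles s).Finite := by
  refine (toFinite {(-(I * ((2 * s - 1) / 4))).re, (I * ((2 * s - 1) / 4)).re}).subset ?_
  intro v hv
  rw [kernelPoles, mem_ofPred_eq, kernelDen_eq_mul] at hv
  simp only [mul_eq_zero, OfNat.ofNat_ne_zero, false_or] at hv
  rcases hv with h | h
  · left
    rw [← eq_neg_of_add_eq_zero_left h, ofReal_re]
  · right
    rw [mem_singleton_iff, ← sub_eq_zero.mp h, ofReal_re]

lemma kernelPoles_eq_empty {s : ℂ} (hs : s.re ≠ 1 / 2) : kernelPoles s = ∅ := by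
  refine eq_empty_of_forall_notMem fun v hv => hs ?_
  rw [kernelPoles, mem_ofPred_eq, kernelDen_eq_mul] at hv
  simp only [mul_eq_zero, OfNat.ofNat_ne_zero, false_or] at hv
  rcases hv with h | h <;>
  · have := congrArg Complex.im h
    simp at this
    linarith

/-- The zeros are ±w with w = i(2s-1)/4. If w is real, both are excised and each linear factor is at
least ε; otherwise each is at least |Im w|. -/
lemma exists_le_norm_kernelDen (s : ℂ) {ε : ℝ} (hε : 0 < ε) :
    ∃ δ > 0, ∀ v ∈ excised (kernelPoles s) ε, δ ≤ ‖kernelDen s v‖ := by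
  set w : ℂ := I * ((2 * s - 1) / 4) with hw
  by_cases h : w.im = 0
  · have hwr : w = (w.re : ℂ) := Complex.ext (by simp) (by simp [h])
    have hp1 : w.re ∈ kernelPoles s := by
      rw [kernelPoles, mem_ofPred_eq, kernelDen_eq_mul, ← hw, ← hwr]; ring
    have hp2 : -w.re ∈ kernelPoles s := neg_mem_kernelPoles s _ hp1
    refine ⟨2 * (ε * ε), by positivity, fun v hv => ?_⟩
    have h1 := hv _ hp1
    have h2 := hv _ hp2
    rw [kernelDen_eq_mul, ← hw, hwr, ← ofReal_add, ← ofReal_sub, norm_mul, norm_mul,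
      Complex.norm_real, Complex.norm_real, Complex.norm_ofNat, Real.norm_eq_abs, Real.norm_eq_abs]
    rw [sub_neg_eq_add] at h2
    gcongr
  · have hpos : 0 < |w.im| := abs_pos.mpr h
    refine ⟨2 * (|w.im| * |w.im|), by positivity, fun v _ => ?_⟩
    rw [kernelDen_eq_mul, ← hw, norm_mul, norm_mul, Complex.norm_ofNat]
    gcongr
    · simpa using abs_im_le_norm ((v : ℂ) + w)
    · simpa using abs_im_le_norm ((v : ℂ) - w)

lemma exists_one_add_sq_le_kernelDen (s : ℂ) {ε : ℝ} (hε : 0 < ε) :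
    ∃ C, 0 ≤ C ∧ ∀ v ∈ excised (kernelPoles s) ε, 1 + v ^ 2 ≤ C * ‖kernelDen s v‖ := by
  obtain ⟨δ, hδ, h⟩ := exists_le_norm_kernelDen s hε
  set M : ℝ := ‖(2 * s - 1) ^ 2 / 8‖
  refine ⟨(1 + M) / δ + 1, by positivity, fun v hv => ?_⟩
  have h1 : 2 * v ^ 2 ≤ ‖kernelDen s v‖ + M := by
    have := norm_sub_le (kernelDen s v) ((2 * s - 1) ^ 2 / 8)
    rw [show kernelDen s v - (2 * s - 1) ^ 2 / 8 = ((2 * v ^ 2 : ℝ) : ℂ) by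
      rw [kernelDen]; push_cast; ring, Complex.norm_real, Real.norm_of_nonneg (by positivity)] at this
    exact this
  have h2 : 1 + M ≤ (1 + M) / δ * ‖kernelDen s v‖ := by
    rw [div_mul_eq_mul_div, le_div_iff₀ hδ]
    gcongr
    exact h v hv
  nlinarith [sq_nonneg v]

lemma continuous_kernelDen (s : ℂ) : Continuous (kernelDen s) := by
  unfold kernelDen
  fun_prop

/-- The odd function that carries the singularities of the kernel. -/
noncomputable def oddKernel (s : ℂ) (v : ℝ) : ℂ := v / kernelDen s v * critZeta v

lemma hasPV_oddKernel (s : ℂ) : HasPV (oddKernel s) (kernelPoles s) 0 := by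
  refine hasPV_of_odd (finite_kernelPoles s) (neg_mem_kernelPoles s) (fun v => ?_) fun ε hε => ?_
  · simp only [oddKernel, kernelDen_neg, critZeta_neg, ofReal_neg]; ring
  obtain ⟨C, hC0, hC⟩ := exists_one_add_sq_le_kernelDen s hε
  refine Integrable.mono' (integrable_critZeta.norm.const_mul C).integrableOn ?_ ?_
  · exact ((measurable_ofReal.div (continuous_kernelDen s).measurable).mul
      continuous_critZeta.measurable).aestronglyMeasurable
  · filter_upwards [ae_restrict_mem (measurableSet_excised (finite_kernelPoles s) ε)] with v hv
    rw [oddKernel, norm_mul, norm_div, Complex.norm_real, Real.norm_eq_abs]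
    gcongr
    refine div_le_of_le_mul₀ (norm_nonneg _) hC0 (le_trans ?_ (hC v hv))
    rw [← sq_abs]
    nlinarith [sq_nonneg (|v| - 1)]

lemma zetaWeight_eq (v : ℝ) :
    zetaWeight v = (1 + 4 * I * v) / (4 * Real.pi) * critZeta v := by
  have hpi : (Real.pi : ℂ) ≠ 0 := ofReal_ne_zero.mpr Real.pi_ne_zero
  have h0 : (1 / 4 + I * v : ℂ) ≠ 0 := fun h => by
    have := congrArg Complex.re h
    norm_num at this
  rw [zetaWeight, critZeta_eq, show (5 / 4 + I * v : ℂ) = 1 / 4 + I * v + 1 by ring,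
    Gamma_add_one _ h0, show (-5 / 4 - I * v : ℂ) = -(1 / 4 + I * v) - 1 by ring,
    cpow_sub _ _ hpi, cpow_one]
  field_simp

lemma xiFun_critLine (v : ℝ) :
    xiFun (1 / 2 + 2 * I * v) = -(16 * v ^ 2 + 1) / 8 * critZeta v := by
  have h0 : (1 / 4 + I * v : ℂ) ≠ 0 := fun h => by
    have := congrArg Complex.re h
    norm_num at this
  rw [xiFun, critZeta_eq, show (1 + (1 / 2 + 2 * I * v) / 2 : ℂ) = 1 / 4 + I * v + 1 by ring,
    Gamma_add_one _ h0, show (-(1 / 2 + 2 * I * v) / 2 : ℂ) = -(1 / 4 + I * v) by ring]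
  linear_combination (2 * v ^ 2 * (Real.pi : ℂ) ^ (-(1 / 4 + I * v) : ℂ) *
    Gamma (1 / 4 + I * v) * riemannZeta (1 / 2 + 2 * I * v)) * I_sq

lemma xiFun_div_eq (v : ℝ) :
    xiFun (1 / 2 + 2 * I * v) / (16 * (v : ℂ) ^ 2 + 1) = -(1 / 8) * critZeta v := by
  have h : (16 * (v : ℂ) ^ 2 + 1) ≠ 0 := by
    exact_mod_cast (show (16 * v ^ 2 + 1 : ℝ) ≠ 0 by positivity)
  rw [xiFun_critLine]
  field_simp

lemma mainIntegrand_eq (s : ℂ) {v : ℝ} (hv : v ∉ kernelPoles s) :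
    mainIntegrand s v = -1 / (2 * Real.pi) * critZeta v +
      I * (1 - (2 * s - 1) ^ 2) / (4 * Real.pi) * oddKernel s v := by
  have hpi : (Real.pi : ℂ) ≠ 0 := ofReal_ne_zero.mpr Real.pi_ne_zero
  have hD : kernelDen s v ≠ 0 := hv
  rw [mainIntegrand, oddKernel, zetaWeight_eq]
  field_simp
  rw [kernelDen]
  linear_combination (32 * v ^ 2 * critZeta v) * I_sq

lemma hasPV_mainIntegrand (s : ℂ) : HasPV (mainIntegrand s) (kernelPoles s) (cstVal : ℂ) := by
  have hpi : (Real.pi : ℂ) ≠ 0 := ofReal_ne_zero.mpr Real.pi_ne_zero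
  have hS := finite_kernelPoles s
  have h := ((hasPV_of_integrable hS integrable_critZeta).const_mul (-1 / (2 * Real.pi))).add
    ((hasPV_oddKernel s).const_mul (I * (1 - (2 * s - 1) ^ 2) / (4 * Real.pi)))
  rw [integral_critZeta_eq_cstVal] at h
  have hc : -1 / (2 * Real.pi) * -(2 * Real.pi * (cstVal : ℂ)) +
      I * (1 - (2 * s - 1) ^ 2) / (4 * Real.pi) * 0 = (cstVal : ℂ) := by
    field_simp
    ring
  rw [hc] at h
  exact h.congr hS fun v hv => (mainIntegrand_eq s hv).symm

lemma derivIntegrand_eq (s : ℂ) (v : ℝ) :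
    derivIntegrand s v =
      -I / (4 * Real.pi) * (v * (1 + 16 * v ^ 2) / kernelDen s v ^ 2 * critZeta v) := by
  rw [derivIntegrand, zetaWeight_eq]
  linear_combination (-4 * v ^ 2 * critZeta v / (4 * Real.pi) / kernelDen s v ^ 2) * I_sq

lemma hasPV_derivIntegrand (s : ℂ) : HasPV (derivIntegrand s) (kernelPoles s) 0 := by
  have hS := finite_kernelPoles s
  have key : HasPV (fun v : ℝ => v * (1 + 16 * v ^ 2) / kernelDen s v ^ 2 * critZeta v)
      (kernelPoles s) 0 := by
    refine hasPV_of_odd hS (neg_mem_kernelPoles s) (fun v => ?_) fun ε hε => ?_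
    · simp only [kernelDen_neg, critZeta_neg, ofReal_neg]; ring
    obtain ⟨C, hC0, hC⟩ := exists_one_add_sq_le_kernelDen s hε
    refine Integrable.mono' (integrable_critZeta.norm.const_mul (16 * C ^ 2)).integrableOn ?_ ?_
    · exact (((by fun_prop : Measurable fun v : ℝ => (v : ℂ) * (1 + 16 * (v : ℂ) ^ 2)).div
        ((continuous_kernelDen s).measurable.pow_const 2)).mul
        continuous_critZeta.measurable).aestronglyMeasurable
    · filter_upwards [ae_restrict_mem (measurableSet_excised hS ε)] with v hv
      have hn : ‖(v : ℂ) * (1 + 16 * v ^ 2)‖ = |v| * (1 + 16 * v ^ 2) := by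
        rw [show (v : ℂ) * (1 + 16 * v ^ 2) = ((v * (1 + 16 * v ^ 2) : ℝ) : ℂ) by push_cast; ring,
          Complex.norm_real, norm_mul, Real.norm_eq_abs,
          Real.norm_of_nonneg (show 0 ≤ 1 + 16 * v ^ 2 by positivity)]
      rw [norm_mul, norm_div, hn, norm_pow]
      gcongr
      refine div_le_of_le_mul₀ (by positivity) (by positivity) ?_
      have h1 : |v| ≤ 1 + v ^ 2 := by
        rw [← sq_abs]
        nlinarith [sq_nonneg (|v| - 1)]
      calc |v| * (1 + 16 * v ^ 2) ≤ (1 + v ^ 2) * (16 * (1 + v ^ 2)) := by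
            gcongr
            linarith
        _ ≤ (C * ‖kernelDen s v‖) * (16 * (C * ‖kernelDen s v‖)) := by
            have := hC v hv
            gcongr
        _ = _ := by ring
  have h := key.const_mul (-I / (4 * Real.pi))
  rw [mul_zero] at h
  exact h.congr hS fun v _ => (derivIntegrand_eq s v).symm

lemma mainIntegrand_eq_neg_lineIntegrand (s : ℂ) (v : ℝ) :
    mainIntegrand s v = -lineIntegrand (-5 / 4) s v := by
  have e1 : (((-5 / 4 : ℝ) : ℂ) - I * v) = -5 / 4 - I * v := by push_cast; ring
  have e2 : (-2 * ((-5 / 4 : ℝ) : ℂ) + 2 * I * v - 2) = 1 / 2 + 2 * I * v := by push_cast; ring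
  have e3 : (-((-5 / 4 : ℝ) : ℂ) + I * v) = 5 / 4 + I * v := by push_cast; ring
  have e4 : (2 * I * v - 2 * s ^ 2 - 2 * ((-5 / 4 : ℝ) : ℂ) + 2 * s - 3) =
      2 * (I * v - (2 * s - 1) ^ 2 / 4) := by push_cast; ring
  have e5 : (-2 * ((-5 / 4 : ℝ) : ℂ) + 2 * I * v + s - 3) *
      (-2 * ((-5 / 4 : ℝ) : ℂ) + 2 * I * v - s - 2) = -(2 * kernelDen s v) := by
    rw [kernelDen]
    push_cast
    linear_combination 4 * (v : ℂ) ^ 2 * I_sq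
  rw [lineIntegrand, e5, e1, e2, e3, e4, div_neg, mul_div_mul_left _ _ (two_ne_zero' ℂ),
    mainIntegrand, zetaWeight]
  ring

lemma hasDerivAt_mainIntegrand (s : ℂ) {v : ℝ} (hv : v ∉ kernelPoles s) :
    HasDerivAt (fun z : ℂ => mainIntegrand z v) ((s - 1 / 2) * derivIntegrand s v) s := by
  have hD : kernelDen s v ≠ 0 := hv
  have hq : HasDerivAt (fun z : ℂ => (2 * z - 1) ^ 2) (4 * (2 * s - 1)) s := by
    convert! (((hasDerivAt_id' s).const_mul 2).sub_const 1).pow 2 using 1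
    simp; ring
  have hn : HasDerivAt (fun z : ℂ => zetaWeight v * (I * v - (2 * z - 1) ^ 2 / 4))
      (zetaWeight v * -(2 * s - 1)) s := by
    convert! ((hq.div_const 4).const_sub (I * v)).const_mul (zetaWeight v) using 1
    ring
  have hd : HasDerivAt (fun z : ℂ => kernelDen z v) ((2 * s - 1) / 2) s := by
    unfold kernelDen
    convert! (hq.div_const 8).add_const (2 * (v : ℂ) ^ 2) using 1
    ring
  convert! hn.div hd hD using 1
  rw [derivIntegrand, ← mul_div_assoc]
  congr 1
  rw [kernelDen]
  ring

end Kernel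

/-! ### Assembly of (a), (b) and (c). -/

theorem mainTheorem3 :
    -- the integrand is (up to the sign) the general one at `c = -5/4`
    (∀ (s : ℂ) (v : ℝ), mainIntegrand s v = -lineIntegrand (-5 / 4) s v) ∧
    -- off the critical line: an absolutely convergent integral with the stated value
    (∀ s : ℂ, s.re ≠ 1 / 2 →
      Integrable (mainIntegrand s) ∧ ∫ v, mainIntegrand s v = (cstVal : ℂ)) ∧
    -- for all `s`, as a principal value
    (∀ s : ℂ, HasPV (mainIntegrand s) (kernelPoles s) (cstVal : ℂ)) ∧
    -- the `s`-derivative of the integral vanishes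
    (∀ s : ℂ, HasDerivAt (fun z : ℂ => pvIntegral (mainIntegrand z) (kernelPoles z)) 0 s) ∧
    -- the `s`-derivative of the integrand
    (∀ (s : ℂ) (v : ℝ), v ∉ kernelPoles s →
      HasDerivAt (fun z : ℂ => mainIntegrand z v) ((s - 1 / 2) * derivIntegrand s v) s) ∧
    -- off the critical line the derivative may be taken under the integral, and vanishes
    (∀ s : ℂ, s.re ≠ 1 / 2 →
      Integrable (derivIntegrand s) ∧
      HasDerivAt (fun z : ℂ => ∫ v, mainIntegrand z v)
        ((s - 1 / 2) * ∫ v, derivIntegrand s v) s ∧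
      (s - 1 / 2) * ∫ v, derivIntegrand s v = 0) ∧
    -- for all `s`, as a principal value
    (∀ s : ℂ, HasPV (derivIntegrand s) (kernelPoles s) 0) ∧
    -- the real part for `s = 1/2 + it`
    (Integrable (fun v : ℝ => xiFun (1 / 2 + 2 * I * v) / (16 * (v : ℂ) ^ 2 + 1)) ∧
      (4 / (Real.pi : ℂ)) * ∫ v : ℝ, xiFun (1 / 2 + 2 * I * v) / (16 * (v : ℂ) ^ 2 + 1) =
        (cstVal : ℂ)) ∧
    -- the imaginary part for `s = 1/2 + it`
    (∀ t : ℝ, HasPV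
      (fun v : ℝ => (v : ℂ) * xiFun (1 / 2 + 2 * I * v) /
        ((4 * (v : ℂ) ^ 2 - (t : ℂ) ^ 2) * (16 * (v : ℂ) ^ 2 + 1)))
      {v : ℝ | 4 * v ^ 2 = t ^ 2} 0) := by
  have hint : ∀ s : ℂ, s.re ≠ 1 / 2 →
      Integrable (mainIntegrand s) ∧ ∫ v, mainIntegrand s v = (cstVal : ℂ) := fun s hs => by
    have h := hasPV_mainIntegrand s
    rw [kernelPoles_eq_empty hs] at h
    exact ⟨h.integrable, h.integral_eq⟩
  refine ⟨mainIntegrand_eq_neg_lineIntegrand, hint, hasPV_mainIntegrand, fun s => ?_,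
    fun s v hv => hasDerivAt_mainIntegrand s hv, fun s hs => ?_, hasPV_derivIntegrand,
    ⟨?_, ?_⟩, fun t => ?_⟩
  · have : (fun z : ℂ => pvIntegral (mainIntegrand z) (kernelPoles z)) = fun _ => (cstVal : ℂ) :=
      funext fun z => (hasPV_mainIntegrand z).pvIntegral_eq
    rw [this]
    exact hasDerivAt_const s _
  · have h := hasPV_derivIntegrand s
    rw [kernelPoles_eq_empty hs] at h
    rw [h.integral_eq, mul_zero]
    -- No domination argument is needed: the integral is constant near `s`, the condition Re z ≠ 1/2
    -- being open, and the integral of K_s is already known to be 0.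
    refine ⟨h.integrable, (hasDerivAt_const s (cstVal : ℂ)).congr_of_eventuallyEq ?_, rfl⟩
    filter_upwards [(isOpen_ne_fun continuous_re continuous_const).mem_nhds hs] with z hz
    exact (hint z hz).2
  · simp only [xiFun_div_eq]
    exact integrable_critZeta.const_mul _
  · have hpi : (Real.pi : ℂ) ≠ 0 := ofReal_ne_zero.mpr Real.pi_ne_zero
    simp only [xiFun_div_eq]
    rw [integral_const_mul, integral_critZeta_eq_cstVal]
    field_simp
    ring
  · have hD : ∀ v : ℝ, kernelDen (1 / 2 + I * t) v = (4 * (v : ℂ) ^ 2 - (t : ℂ) ^ 2) / 2 := by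
      intro v
      rw [kernelDen]
      linear_combination ((t : ℂ) ^ 2 / 2) * I_sq
    have hS : kernelPoles (1 / 2 + I * t) = {v : ℝ | 4 * v ^ 2 = t ^ 2} := by
      ext v
      rw [kernelPoles, Set.mem_ofPred_eq, Set.mem_ofPred_eq, hD, div_eq_zero_iff,
        or_iff_left (two_ne_zero' ℂ), sub_eq_zero]
      exact_mod_cast Iff.rfl
    -- The factor is -1/8 from ξ/(16v²+1) times 1/2 from D_s = (4v² - t²)/2.
    have h := (hasPV_oddKernel (1 / 2 + I * t)).const_mul (-(1 / 16))
    rw [hS, mul_zero] at h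
    convert h using 2 with v
    rw [oddKernel, hD, mul_comm (4 * (v : ℂ) ^ 2 - (t : ℂ) ^ 2), ← div_div, mul_div_assoc,
      xiFun_div_eq, div_div_eq_mul_div]
    ring
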